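/- Let $M=(\mathcal X,\mathcal A,P,r)$ be a finite Markov decision process that is unichain: every stationary policy $\pi$ has exactly one stationary state distribution, i.e. one probability distribution $\nu$ on $\mathcal X$ with $\nu(y)=\sum_{x,a}P(y|x,a)\pi(a|x)\nu(x)$ for all $y$. Let $\Delta$ be the set of probability distributions $\mu$ on $\mathcal X\times\mathcal A$ with $\sum_b\mu(y,b)=\sum_{x,a}P(y|x,a)\mu(x,a)$ for all $y$; write $\nu_\mu(x)=\sum_a\mu(x,a)$ and $\pi_\mu(a|x)=\mu(x,a)/\nu_\mu(x)$ where $\nu_\mu(x)>0$. Let $\eta>0$, let $\mu'\in\Delta$, and let $\pi_{\mu'}$ be a policy with $\mu'(x,a)=\nu_{\mu'}(x)\pi_{\mu'}(a|x)$ for all $(x,a)$ (it is arbitrary at states with $\nu_{\mu'}(x)=0$) that has full support, i.e. $\pi_{\mu'}(a|x)>0$ for all $a$ whenever $\nu_{\mu'}(x)>0$. Let $D$ be the set of $\mu:\mathcal X\times\mathcal A\to[0,\infty)$ such that $\mu(x,a)=0$ whenever $\pi_{\mu'}(a|x)=0$, put $$D_C(\mu\|\mu')=\sum_{x,a}\mu(x,a)\log\frac{\pi_\mu(a|x)}{\pi_{\mu'}(a|x)}\quad(0\log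 0=0),\qquad \tilde\rho_\eta(\mu)=\sum_{x,a}\mu(x,a)r(x,a)-\frac1\eta D_C(\mu\|\mu'),$$ and let $$\mathcal L(\mu;V,\lambda,\varphi)=\tilde\rho_\eta(\mu)+\sum_yV(y)\Big(\sum_{x,a}P(y|x,a)\mu(x,a)-\sum_b\mu(y,b)\Big)+\lambda\Big(1-\sum_{x,a}\mu(x,a)\Big)+\sum_{x,a}\varphi(x,a)\mu(x,a)$$ be the Lagrangian of the program $\max_{\mu\in\Delta}\tilde\rho_\eta(\mu)$, with dual function $g(V,\lambda,\varphi)=\sup_{\mu\in D}\mathcal L(\mu;V,\lambda,\varphi)\in(-\infty,\infty]$. Then the dual of this program is to minimize $\lambda\in\mathbb R$ subject to the existence of $V:\mathcal X\to\mathbb R$ with $$V(x)=\frac1\eta\log\sum_a\pi_{\mu'}(a|x)\exp\Big(\eta\big(r(x,a)-\lambda+\sum_yP(y|x,a)V(y)\big)\Big)\qquad\text{for all }x,\tag{1}$$ in the following sense. (i) $(V,\lambda)$ satisfies (1) if and only if there are $\varphi\ge0$ and $\mu\in D$ such that $\nu_\mu(x)>0$ for all $x$, $\varphi(x,a)\mu(x,a)=0$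 for all $(x,a)$, and $\mu$ maximizes $\mathcal L(\cdot;V,\lambda,\varphi)$ over $D$. (ii) If $(V,\lambda)$ satisfies (1), then $g(V,\lambda,0)=\lambda$. (iii) (Strong duality.) The maximum $\tilde\rho^*_\eta=\max_{\mu\in\Delta}\tilde\rho_\eta(\mu)$, the minimum of $\lambda$ subject to (1), and the minimum of $g(V,\lambda,\varphi)$ over all $V$, all $\lambda\in\mathbb R$ and all $\varphi\ge0$ are attained and equal. (iv) (Optimal policy.) Let $V^*$ satisfy (1) with $\lambda=\tilde\rho^*_\eta$, let $A^*(x,a)=r(x,a)+\sum_yP(y|x,a)V^*(y)-V^*(x)$, and let $$\pi^*(a|x)=\frac{\pi_{\mu'}(a|x)e^{\eta A^*(x,a)}}{\sum_b\pi_{\mu'}(b|x)e^{\eta A^*(x,b)}}.$$ Then $\pi^*$ is a policy, and $\mu\in\Delta$ maximizes $\tilde\rho_\eta$ over $\Delta$ if and only if $\pi_\mu(a|x)=\pi^*(a|x)$ for all $a$ and all $x$ with $\nu_\mu(x)>0$. -/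

import Mathlib

noncomputable section

/-- A finite Markov decision process: `P x a y` is the probability of moving from `x` to `y` under
action `a`, and `r x a` is the reward. -/
structure FiniteMDP (X A : Type*) [Fintype X] where
  P : X → A → X → ℝ
  r : X → A → ℝ
  P_mem : ∀ x a, P x a ∈ stdSimplex ℝ X

/-- A stationary policy; `π x a` is the probability `π(a|x)`. -/
def IsPolicy {X A : Type*} [Fintype A] (π : X → A → ℝ) : Prop :=
  ∀ x, π x ∈ stdSimplex ℝ A

/-- State marginal `ν_μ(x) = ∑ₐ μ(x,a)`. -/
def stateMarginal {X A : Type*} [Fintype A] (μ : X × A → ℝ) (x : X) : ℝ :=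
  ∑ a, μ (x, a)

/-- Induced policy `π_μ(a|x) = μ(x,a) / ν_μ(x)`; it is meaningful where `ν_μ(x) ≠ 0`. -/
def inducedPolicy {X A : Type*} [Fintype A] (μ : X × A → ℝ) (x : X) (a : A) : ℝ :=
  μ (x, a) / stateMarginal μ x

/-- `π` is a policy version of the conditional distribution `π_μ(·|x)`: it is `μ(x,·) / ν_μ(x)`
where `ν_μ(x) ≠ 0`, and an arbitrary distribution over actions where `ν_μ(x) = 0`. -/
def IsConditionalPolicy {X A : Type*} [Fintype A] (μ : X × A → ℝ) (π : X → A → ℝ) : Prop :=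
  IsPolicy π ∧ ∀ x a, μ (x, a) = stateMarginal μ x * π x a

/-- `D_C(μ‖μ') = ∑ μ(x,a) log (π_μ(a|x) / π'(a|x))`, where `π'` is (a version of) `π_{μ'}`.
It is used for `μ` in its effective domain `condDivDomain π'`, with `0 log 0 = 0`. -/
def condDiv {X A : Type*} [Fintype X] [Fintype A] (π' : X → A → ℝ) (μ : X × A → ℝ) : ℝ :=
  ∑ x, ∑ a, μ (x, a) * Real.log (inducedPolicy μ x a / π' x a)

/-- The effective domain of `D_C(·‖μ')`: nonnegative `μ` that vanish where `π'` does. (If `π'` is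
strictly positive, this is the whole nonnegative orthant.) -/
def condDivDomain {X A : Type*} (π' : X → A → ℝ) : Set (X × A → ℝ) :=
  {μ | (∀ p, 0 ≤ μ p) ∧ ∀ x a, π' x a = 0 → μ (x, a) = 0}

namespace FiniteMDP

variable {X A : Type*} [Fintype X] [Fintype A]

/-- `ν` is a stationary state distribution of the policy `π`. -/
def IsStationaryDist (M : FiniteMDP X A) (π : X → A → ℝ) (ν : X → ℝ) : Prop :=
  ν ∈ stdSimplex ℝ X ∧ ∀ y, ν y = ∑ x, ∑ a, M.P x a y * π x a * ν x

/-- Unichain: every stationary policy has a unique stationary distribution. -/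
def Unichain (M : FiniteMDP X A) : Prop :=
  ∀ π : X → A → ℝ, IsPolicy π → ∃! ν : X → ℝ, M.IsStationaryDist π ν

/-- The set `Δ` of stationary state-action distributions. -/
def stationarySet (M : FiniteMDP X A) : Set (X × A → ℝ) :=
  {μ | μ ∈ stdSimplex ℝ (X × A) ∧
    ∀ y, ∑ b, μ (y, b) = ∑ x, ∑ a, M.P x a y * μ (x, a)}

/-- The regularized average reward `∑ μ r - (1/η) D_C(μ‖μ')`. -/
def regReward (M : FiniteMDP X A) (π' : X → A → ℝ) (η : ℝ) (μ : X × A → ℝ) : ℝ :=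
  ∑ x, ∑ a, μ (x, a) * M.r x a - (1 / η) * condDiv π' μ

/-- The Lagrangian of the program `max_{μ ∈ Δ} regReward μ`, with multipliers `V` for the
stationarity constraints, `lam` for normalization and `φ` for nonnegativity. -/
def lagrangian (M : FiniteMDP X A) (π' : X → A → ℝ) (η : ℝ)
    (V : X → ℝ) (lam : ℝ) (φ : X × A → ℝ) (μ : X × A → ℝ) : ℝ :=
  M.regReward π' η μ
    + ∑ y, V y * (∑ x, ∑ a, M.P x a y * μ (x, a) - ∑ b, μ (y, b))
    + lam * (1 - ∑ x, ∑ a, μ (x, a))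
    + ∑ x, ∑ a, φ (x, a) * μ (x, a)

/-- The Lagrange dual function `g(V, lam, φ) = sup_μ L(μ; V, lam, φ)`, the supremum being over the
effective domain of the regularizer; it takes values in the extended reals. -/
def dualFunction (M : FiniteMDP X A) (π' : X → A → ℝ) (η : ℝ)
    (V : X → ℝ) (lam : ℝ) (φ : X × A → ℝ) : EReal :=
  ⨆ μ ∈ condDivDomain π', ((M.lagrangian π' η V lam φ μ : ℝ) : EReal)

/-- The soft Bellman equations
`V(x) = (1/η) log ∑ₐ π'(a|x) exp (η (r(x,a) - lam + ∑_y P(y|x,a) V(y)))` for all `x`. -/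
def SoftBellman (M : FiniteMDP X A) (π' : X → A → ℝ) (η : ℝ) (V : X → ℝ) (lam : ℝ) : Prop :=
  ∀ x, V x = (1 / η) * Real.log
    (∑ a, π' x a * Real.exp (η * (M.r x a - lam + ∑ y, M.P x a y * V y)))

/-- The advantage function `A(x,a) = r(x,a) + ∑_y P(y|x,a) V(y) - V(x)`. -/
def advantage (M : FiniteMDP X A) (V : X → ℝ) (x : X) (a : A) : ℝ :=
  M.r x a + ∑ y, M.P x a y * V y - V x

/-- The policy proportional to `π'(a|x) exp (η A(x,a))`. -/
def softPolicy (M : FiniteMDP X A) (π' : X → A → ℝ) (η : ℝ) (V : X → ℝ) (x : X) (a : A) : ℝ :=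
  π' x a * Real.exp (η * M.advantage V x a)
    / ∑ b, π' x b * Real.exp (η * M.advantage V x b)

end FiniteMDP

end

/-! Grouped by states, the Lagrangian is `lam` plus a sum of entropy-regularized payoffs of the
measures `μ(x,·)`, with payoff `A(x,a) - lam + φ(x,a)` (`lagrangian_eq`). The Gibbs variational
principle bounds each of them by the mass `ν_μ(x)` times a log-partition function, with equality
exactly for multiples of the Gibbs distribution (`freeEnergy_le`, `freeEnergy_eq_iff`). The soft
Bellman equations say that with `φ = 0` all these log-partition functions vanish. Then `lam` bounds
the Lagrangian, and equality holds exactly when `μ` follows the soft policy. A stationary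
distribution of that policy is primal feasible and attains `lam`, so every solution of the soft
Bellman equations has the primal optimum as its `lam`; weak duality gives the rest.

Two points need the unichain hypothesis in earnest. Solvability (`Unichain.exists_softBellman`) is a
vanishing-discount argument: the discounted equation is a contraction, and its solutions have
bounded oscillation because each nearly solves a Poisson equation for one of finitely many
deterministic policies, where harmonic functions are constant. Feasible measures also have to lie in
the domain of the regularizer (`Unichain.stationarySet_subset_condDivDomain`): full support makes
the support of `ν_μ'` a closed class, which must carry every stationary distribution. -/

open Filter Topology

/-! ### Log-partition functions and the Gibbs variational principle. -/

section LogSumExp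

variable {A : Type*} [Fintype A]

/-- The scaled log-partition function `(1/η) log ∑ₐ p(a) exp (η f(a))`. -/
noncomputable def logPartition (η : ℝ) (p f : A → ℝ) : ℝ :=
  (1 / η) * Real.log (∑ a, p a * Real.exp (η * f a))

/-- The Gibbs distribution proportional to `p(a) exp (η f(a))`. -/
noncomputable def gibbs (η : ℝ) (p f : A → ℝ) (a : A) : ℝ :=
  p a * Real.exp (η * f a) / ∑ b, p b * Real.exp (η * f b)

/-- The entropy-regularized payoff of an unnormalized distribution `q` relative to `p`. -/
noncomputable def freeEnergy (η : ℝ) (p f q : A → ℝ) : ℝ :=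
  ∑ a, q a * f a - (1 / η) * ∑ a, q a * Real.log (q a / (∑ b, q b) / p a)

lemma sum_mul_exp_pos {p : A → ℝ} (hp : p ∈ stdSimplex ℝ A) (f : A → ℝ) :
    0 < ∑ a, p a * Real.exp (f a) := by
  have h0 : ∀ a ∈ Finset.univ, 0 ≤ p a * Real.exp (f a) :=
    fun a _ => mul_nonneg (hp.1 a) (Real.exp_pos _).le
  refine (Finset.sum_nonneg h0).lt_of_ne' fun h => ?_
  rw [Finset.sum_eq_zero_iff_of_nonneg h0] at h
  have : ∑ a, p a = 0 := Finset.sum_eq_zero fun a ha =>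
    (mul_eq_zero.1 (h a ha)).resolve_right (Real.exp_pos _).ne'
  linarith [hp.2]

lemma logPartition_add_const {η : ℝ} (hη : 0 < η) {p : A → ℝ} (hp : p ∈ stdSimplex ℝ A)
    (f : A → ℝ) (c : ℝ) :
    logPartition η p (fun a => f a + c) = logPartition η p f + c := by
  have : ∑ a, p a * Real.exp (η * (f a + c))
      = (∑ a, p a * Real.exp (η * f a)) * Real.exp (η * c) := by
    rw [Finset.sum_mul]
    refine Finset.sum_congr rfl fun a _ => ?_
    rw [mul_add, Real.exp_add, mul_assoc]
  unfold logPartition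
  rw [this, Real.log_mul (sum_mul_exp_pos hp _).ne' (Real.exp_pos _).ne', Real.log_exp]
  field_simp

lemma logPartition_mono {η : ℝ} (hη : 0 < η) {p : A → ℝ} (hp : p ∈ stdSimplex ℝ A)
    {f g : A → ℝ} (h : ∀ a, p a ≠ 0 → f a ≤ g a) : logPartition η p f ≤ logPartition η p g := by
  unfold logPartition
  refine mul_le_mul_of_nonneg_left (Real.log_le_log (sum_mul_exp_pos hp _) ?_) (by positivity)
  refine Finset.sum_le_sum fun a _ => ?_
  by_cases ha : p a = 0
  · simp [ha]
  · have := hp.1 a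
    have := h a ha
    gcongr

lemma logPartition_congr {η : ℝ} {p f g : A → ℝ} (h : ∀ a, p a ≠ 0 → f a = g a) :
    logPartition η p f = logPartition η p g := by
  unfold logPartition
  congr 2
  refine Finset.sum_congr rfl fun a _ => ?_
  by_cases ha : p a = 0
  · simp [ha]
  · rw [h a ha]

lemma logPartition_const {η : ℝ} (hη : 0 < η) {p : A → ℝ} (hp : p ∈ stdSimplex ℝ A) (c : ℝ) :
    logPartition η p (fun _ => c) = c := by
  have := logPartition_add_const hη hp (fun _ => 0) c
  simpa [logPartition, hp.2] using this

lemma add_log_le_logPartition {η : ℝ} (hη : 0 < η) {p : A → ℝ} (hp : p ∈ stdSimplex ℝ A)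
    (f : A → ℝ) {a : A} (ha : p a ≠ 0) :
    f a + (1 / η) * Real.log (p a) ≤ logPartition η p f := by
  have hpa : 0 < p a := (hp.1 a).lt_of_ne' ha
  have h1 : p a * Real.exp (η * f a) ≤ ∑ a, p a * Real.exp (η * f a) :=
    Finset.single_le_sum (f := fun a => p a * Real.exp (η * f a))
      (fun a _ => mul_nonneg (hp.1 a) (Real.exp_pos _).le) (Finset.mem_univ a)
  have h2 := Real.log_le_log (by positivity) h1
  rw [Real.log_mul ha (Real.exp_pos _).ne', Real.log_exp] at h2
  have h3 := mul_le_mul_of_nonneg_left h2 (by positivity : 0 ≤ 1 / η)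
  refine le_trans (le_of_eq ?_) h3
  field_simp
  ring

/-- Up to an error that only depends on `p`, the log-partition function is the payoff of some
action in the support of `p`. -/
lemma exists_abs_logPartition_sub_le {η : ℝ} (hη : 0 < η) {p : A → ℝ}
    (hp : p ∈ stdSimplex ℝ A) (f : A → ℝ) :
    ∃ a, |logPartition η p f - f a| ≤ ∑ b, (1 / η) * |Real.log (p b)| := by
  have hne : (Finset.univ.filter fun a => p a ≠ 0).Nonempty := by
    by_contra h
    rw [Finset.not_nonempty_iff_eq_empty, Finset.filter_eq_empty_iff] at h
    have : ∑ a, p a = 0 := Finset.sum_eq_zero fun a ha => by simpa using h ha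
    linarith [hp.2]
  obtain ⟨a, ha, hmax⟩ := Finset.exists_max_image _ f hne
  have ha0 : p a ≠ 0 := by simpa using ha
  -- Since `a` maximizes `f` on the support of `p`, the constant `f a` dominates `f` there.
  have hub : logPartition η p f ≤ f a := by
    rw [← logPartition_const hη hp (f a)]
    exact logPartition_mono hη hp fun b hb => hmax b (by simpa using hb)
  have hlb := add_log_le_logPartition hη hp f ha0
  have hs : (1 / η) * |Real.log (p a)| ≤ ∑ b, (1 / η) * |Real.log (p b)| :=
    Finset.single_le_sum (f := fun b => (1 / η) * |Real.log (p b)|)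
      (fun b _ => by positivity) (Finset.mem_univ a)
  have hl : (1 / η) * (-|Real.log (p a)|) ≤ (1 / η) * Real.log (p a) :=
    mul_le_mul_of_nonneg_left (neg_abs_le _) (by positivity)
  refine ⟨a, abs_le.2 ⟨by linarith, ?_⟩⟩
  have : 0 ≤ (1 / η) * |Real.log (p a)| := by positivity
  linarith

lemma gibbs_mem_stdSimplex {η : ℝ} {p : A → ℝ} (hp : p ∈ stdSimplex ℝ A) (f : A → ℝ) :
    gibbs η p f ∈ stdSimplex ℝ A := by
  have hZ := sum_mul_exp_pos hp fun a => η * f a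
  refine ⟨fun a => div_nonneg (mul_nonneg (hp.1 a) (Real.exp_pos _).le) hZ.le, ?_⟩
  unfold gibbs
  rw [← Finset.sum_div, div_self hZ.ne']

lemma gibbs_pos {η : ℝ} {p : A → ℝ} (hp : p ∈ stdSimplex ℝ A) (f : A → ℝ) {a : A}
    (ha : p a ≠ 0) : 0 < gibbs η p f a :=
  div_pos (mul_pos ((hp.1 a).lt_of_ne' ha) (Real.exp_pos _)) (sum_mul_exp_pos hp _)

lemma gibbs_add_const {η : ℝ} (p f : A → ℝ) (c : ℝ) :
    gibbs η p (fun a => f a + c) = gibbs η p f := by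
  ext a
  have h : ∀ a, p a * Real.exp (η * (f a + c))
      = p a * Real.exp (η * f a) * Real.exp (η * c) := fun a => by
    rw [mul_add, Real.exp_add, mul_assoc]
  unfold gibbs
  simp_rw [h]
  rw [← Finset.sum_mul, mul_div_mul_right _ _ (Real.exp_pos _).ne']

/-- The Gibbs variational identity. -/
lemma mul_logPartition_sub_freeEnergy {η : ℝ} (hη : 0 < η) {p : A → ℝ}
    (hp : p ∈ stdSimplex ℝ A) (f : A → ℝ) {q : A → ℝ} (hq : ∀ a, 0 ≤ q a)
    (hqp : ∀ a, p a = 0 → q a = 0) :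
    η * ((∑ a, q a) * logPartition η p f - freeEnergy η p f q)
      = ∑ a, (∑ b, q b) * gibbs η p f a
          * InformationTheory.klFun (q a / ((∑ b, q b) * gibbs η p f a)) := by
  have hZ := sum_mul_exp_pos hp fun a => η * f a
  have hw := gibbs_mem_stdSimplex (η := η) hp f
  set s := ∑ b, q b with hs
  -- Here `klFun u = u * log u + 1 - u`. The correction `s * gibbs η p f a - q a` sums to zero over
  -- `a`, both terms having total mass `s`.
  have key : ∀ a, s * gibbs η p f a * InformationTheory.klFun (q a / (s * gibbs η p f a))
      = η * (q a * logPartition η p f - q a * f a) + q a * Real.log (q a / s / p a)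
        + (s * gibbs η p f a - q a) := by
    intro a
    by_cases hqa : q a = 0
    · simp [hqa, InformationTheory.klFun]
    have hq0 : 0 < q a := (hq a).lt_of_ne' hqa
    have hp0 : 0 < p a := (hp.1 a).lt_of_ne' fun h => hqa (hqp a h)
    have hs0 : 0 < s := hq0.trans_le
      (Finset.single_le_sum (f := q) (fun b _ => hq b) (Finset.mem_univ a))
    have hg := gibbs_pos (η := η) hp f hp0.ne'
    have hlog : Real.log (q a / (s * gibbs η p f a))
        = Real.log (q a / s / p a) - η * f a + η * logPartition η p f := by
      have : q a / (s * gibbs η p f a)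
          = q a / s / p a / Real.exp (η * f a) * ∑ a, p a * Real.exp (η * f a) := by
        unfold gibbs
        field_simp
      rw [this, Real.log_mul (by positivity) hZ.ne', Real.log_div (by positivity)
        (Real.exp_pos _).ne', Real.log_exp]
      unfold logPartition
      field_simp
    rw [InformationTheory.klFun, hlog]
    field_simp
    ring
  rw [Finset.sum_congr rfl fun a _ => key a]
  simp only [Finset.sum_add_distrib, Finset.sum_sub_distrib, ← Finset.mul_sum,
    ← Finset.sum_mul, hw.2, ← hs]
  unfold freeEnergy
  rw [← hs]
  field_simp
  ring

lemma freeEnergy_le {η : ℝ} (hη : 0 < η) {p : A → ℝ}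
    (hp : p ∈ stdSimplex ℝ A) (f : A → ℝ) {q : A → ℝ} (hq : ∀ a, 0 ≤ q a)
    (hqp : ∀ a, p a = 0 → q a = 0) :
    freeEnergy η p f q ≤ (∑ a, q a) * logPartition η p f := by
  have h := mul_logPartition_sub_freeEnergy hη hp f hq hqp
  have hs : 0 ≤ ∑ a, q a := Finset.sum_nonneg fun a _ => hq a
  have : 0 ≤ η * ((∑ a, q a) * logPartition η p f - freeEnergy η p f q) := by
    rw [h]
    refine Finset.sum_nonneg fun a _ => ?_
    have hg := (gibbs_mem_stdSimplex (η := η) hp f).1 a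
    exact mul_nonneg (mul_nonneg hs hg)
      (InformationTheory.klFun_nonneg (div_nonneg (hq a) (mul_nonneg hs hg)))
  linarith [nonneg_of_mul_nonneg_right this hη]

/-- The gap is a sum of nonnegative `klFun` terms, and `klFun` vanishes only at `1`. -/
lemma freeEnergy_eq_iff {η : ℝ} (hη : 0 < η) {p : A → ℝ}
    (hp : p ∈ stdSimplex ℝ A) (f : A → ℝ) {q : A → ℝ} (hq : ∀ a, 0 ≤ q a)
    (hqp : ∀ a, p a = 0 → q a = 0) :
    freeEnergy η p f q = (∑ a, q a) * logPartition η p f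
      ↔ ∀ a, q a = (∑ b, q b) * gibbs η p f a := by
  have h := mul_logPartition_sub_freeEnergy hη hp f hq hqp
  have hs : 0 ≤ ∑ a, q a := Finset.sum_nonneg fun a _ => hq a
  have hg := (gibbs_mem_stdSimplex (η := η) hp f).1
  have hnn : ∀ a ∈ Finset.univ, 0 ≤ (∑ b, q b) * gibbs η p f a
      * InformationTheory.klFun (q a / ((∑ b, q b) * gibbs η p f a)) := fun a _ =>
    mul_nonneg (mul_nonneg hs (hg a))
      (InformationTheory.klFun_nonneg (div_nonneg (hq a) (mul_nonneg hs (hg a))))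
  have h1 : freeEnergy η p f q = (∑ a, q a) * logPartition η p f
      ↔ η * ((∑ a, q a) * logPartition η p f - freeEnergy η p f q) = 0 := by
    rw [mul_eq_zero, or_iff_right hη.ne', sub_eq_zero, eq_comm]
  rw [h1, h, Finset.sum_eq_zero_iff_of_nonneg hnn]
  refine forall_congr' fun a => ?_
  simp only [Finset.mem_univ, true_implies]
  by_cases h0 : (∑ b, q b) * gibbs η p f a = 0
  -- A zero weight kills the `klFun` term whatever `q a` is, so `q a = 0` has to come from zero
  -- total mass or from `hqp`.
  · simp only [h0, zero_mul, true_iff]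
    rcases mul_eq_zero.1 h0 with h0 | h0
    · exact (Finset.sum_eq_zero_iff_of_nonneg fun b _ => hq b).1 h0 a (Finset.mem_univ a)
    · exact hqp a (by_contra fun hpa => (gibbs_pos hp f hpa).ne' h0)
  · rw [mul_eq_zero, or_iff_right h0, InformationTheory.klFun_eq_zero_iff
      (div_nonneg (hq a) (mul_nonneg hs (hg a))), div_eq_one_iff_eq h0]

end LogSumExp

/-! ### Stationary distributions, harmonic functions and the Poisson equation. -/

/-- A linear self-map of a nonempty compact convex set has a fixed point. -/
lemma exists_isFixedPt_of_isCompact_convex {E : Type*} [NormedAddCommGroup E] [NormedSpace ℝ E]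
    (T : E →L[ℝ] E) {K : Set E} (hK : IsCompact K) (hconv : Convex ℝ K) (hne : K.Nonempty)
    (hT : Set.MapsTo T K K) : ∃ v ∈ K, T v = v := by
  obtain ⟨v, hv⟩ := hne
  have horb : ∀ n, T^[n] v ∈ K := fun n => hT.iterate n hv
  -- The index is `n + 1` because the empty average is `0`, which need not lie in `K`.
  have havg : ∀ n, birkhoffAverage ℝ T id (n + 1) v ∈ K := fun n => by
    rw [birkhoffAverage, birkhoffSum, Finset.smul_sum]
    refine hconv.sum_mem (fun _ _ => by positivity) ?_ fun k _ => horb k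
    simp only [Finset.sum_const, Finset.card_range, nsmul_eq_mul]
    exact mul_inv_cancel₀ (by positivity)
  obtain ⟨w, hw, φ, hφ, hlim⟩ := hK.tendsto_subseq havg
  refine ⟨w, hw, ?_⟩
  have hbd : Bornology.IsBounded (Set.range fun n => (id (T^[n] v) : E)) :=
    hK.isBounded.subset (Set.range_subset_iff.2 horb)
  have h0 := tendsto_birkhoffAverage_apply_sub_birkhoffAverage ℝ (f := T) (g := id) (x := v) hbd
  have h1 := (h0.comp (tendsto_add_atTop_nat 1)).comp hφ.tendsto_atTop
  have h2 : Tendsto (fun n => T (birkhoffAverage ℝ T id (φ n + 1) v)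
      - birkhoffAverage ℝ T id (φ n + 1) v) atTop (𝓝 (T w - w)) :=
    ((T.continuous.tendsto w).comp hlim).sub hlim
  have h3 := tendsto_nhds_unique h2 (h1.congr fun n => by
    simp only [Function.comp, birkhoffAverage, birkhoffSum, map_smul, map_sum, id,
      ← Function.iterate_succ_apply, ← Function.iterate_succ_apply'])
  exact sub_eq_zero.1 h3

namespace FiniteMDP

variable {X A : Type*} [Fintype X] [Fintype A]

/-- The action of the transition matrix of a policy on state measures. -/
def pushMeasure (M : FiniteMDP X A) (π : X → A → ℝ) : (X → ℝ) →ₗ[ℝ] (X → ℝ) where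
  toFun ν y := ∑ x, ∑ a, M.P x a y * π x a * ν x
  map_add' ν ν' := by
    ext y
    simp only [Pi.add_apply, mul_add, Finset.sum_add_distrib]
  map_smul' c ν := by
    ext y
    simp only [Pi.smul_apply, smul_eq_mul, Finset.mul_sum, RingHom.id_apply]
    exact Finset.sum_congr rfl fun x _ => Finset.sum_congr rfl fun a _ => by ring

/-- The action of the transition matrix of a policy on functions of the state. -/
def expect (M : FiniteMDP X A) (π : X → A → ℝ) : (X → ℝ) →ₗ[ℝ] (X → ℝ) where
  toFun h x := ∑ a, π x a * ∑ y, M.P x a y * h y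
  map_add' h h' := by
    ext x
    simp only [Pi.add_apply, mul_add, Finset.sum_add_distrib]
  map_smul' c h := by
    ext x
    simp only [Pi.smul_apply, smul_eq_mul, Finset.mul_sum, RingHom.id_apply]
    exact Finset.sum_congr rfl fun x _ => Finset.sum_congr rfl fun a _ => by ring

lemma pushMeasure_apply (M : FiniteMDP X A) (π : X → A → ℝ) (ν : X → ℝ) (y : X) :
    M.pushMeasure π ν y = ∑ x, ∑ a, M.P x a y * π x a * ν x := rfl

lemma expect_apply (M : FiniteMDP X A) (π : X → A → ℝ) (h : X → ℝ) (x : X) :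
    M.expect π h x = ∑ a, π x a * ∑ y, M.P x a y * h y := rfl

lemma isStationaryDist_iff {M : FiniteMDP X A} {π : X → A → ℝ} {ν : X → ℝ} :
    M.IsStationaryDist π ν ↔ ν ∈ stdSimplex ℝ X ∧ M.pushMeasure π ν = ν :=
  and_congr_right fun _ => ⟨fun h => funext fun y => (h y).symm, fun h y => (congrFun h y).symm⟩

lemma sum_pushMeasure_mul (M : FiniteMDP X A) (π : X → A → ℝ) (ν h : X → ℝ) :
    ∑ y, M.pushMeasure π ν y * h y = ∑ x, ν x * M.expect π h x := by
  simp only [pushMeasure_apply, expect_apply, Finset.sum_mul, Finset.mul_sum]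
  rw [Finset.sum_comm]
  refine Finset.sum_congr rfl fun x _ => ?_
  rw [Finset.sum_comm]
  exact Finset.sum_congr rfl fun a _ => Finset.sum_congr rfl fun y _ => by ring

lemma expect_const (M : FiniteMDP X A) {π : X → A → ℝ} (hπ : IsPolicy π) (c : ℝ) :
    M.expect π (fun _ => c) = fun _ => c := by
  ext x
  simp only [expect_apply, ← Finset.sum_mul, (M.P_mem x _).2, (hπ x).2, one_mul]

lemma pushMeasure_mem_stdSimplex (M : FiniteMDP X A) {π : X → A → ℝ} (hπ : IsPolicy π)
    {ν : X → ℝ} (hν : ν ∈ stdSimplex ℝ X) : M.pushMeasure π ν ∈ stdSimplex ℝ X := by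
  refine ⟨fun y => Finset.sum_nonneg fun x _ => Finset.sum_nonneg fun a _ =>
    mul_nonneg (mul_nonneg ((M.P_mem x a).1 y) ((hπ x).1 a)) (hν.1 x), ?_⟩
  have := M.sum_pushMeasure_mul π ν fun _ => 1
  rw [M.expect_const hπ] at this
  simpa [hν.2] using this

/-- A closed convex set of distributions that is invariant under a policy contains a stationary
distribution of that policy. -/
lemma exists_isStationaryDist_mem (M : FiniteMDP X A) {π : X → A → ℝ} (hπ : IsPolicy π)
    {K : Set (X → ℝ)} (hK : IsClosed K) (hconv : Convex ℝ K)
    (hne : (stdSimplex ℝ X ∩ K).Nonempty)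
    (hinv : ∀ ν ∈ stdSimplex ℝ X, ν ∈ K → M.pushMeasure π ν ∈ K) :
    ∃ ν ∈ K, M.IsStationaryDist π ν := by
  obtain ⟨ν, hν, hfix⟩ := exists_isFixedPt_of_isCompact_convex
    (LinearMap.toContinuousLinearMap (M.pushMeasure π))
    ((isCompact_stdSimplex ℝ X).inter_right hK) ((convex_stdSimplex ℝ X).inter hconv) hne
    fun ν hν => ⟨M.pushMeasure_mem_stdSimplex hπ hν.1, hinv ν hν.1 hν.2⟩
  exact ⟨ν, hν.2, isStationaryDist_iff.2 ⟨hν.1, hfix⟩⟩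

/-- In a unichain MDP, the harmonic functions of a policy are constant. -/
lemma Unichain.harmonic_const {M : FiniteMDP X A} (hM : M.Unichain) {π : X → A → ℝ}
    (hπ : IsPolicy π) {h : X → ℝ} (hh : M.expect π h = h) (x y : X) : h x = h y := by
  classical
  -- Harmonicity makes the set of `ν` with mean `h x` invariant, and it contains the Dirac mass at
  -- `x`. Uniqueness of the stationary distribution then identifies `h x` with `h y`.
  have key : ∀ x, ∃ ν ∈ {ν : X → ℝ | ∑ z, ν z * h z = h x}, M.IsStationaryDist π ν := by
    intro x
    refine M.exists_isStationaryDist_mem hπ (isClosed_eq (by fun_prop) continuous_const) ?_ ?_ ?_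
    · intro ν hν ν' hν' s t _ _ hst
      simp only [Set.mem_ofPred_eq, Pi.add_apply, Pi.smul_apply, smul_eq_mul, add_mul,
        Finset.sum_add_distrib, mul_assoc, ← Finset.mul_sum] at hν hν' ⊢
      rw [hν, hν', ← add_mul, hst, one_mul]
    · exact ⟨Pi.single x 1, single_mem_stdSimplex ℝ x, by simp [Pi.single_apply]⟩
    · intro ν _ hν
      rw [Set.mem_ofPred_eq, sum_pushMeasure_mul, hh]
      exact hν
  obtain ⟨ν, hν, hνs⟩ := key x
  obtain ⟨ν', hν', hνs'⟩ := key y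
  rw [← hν, ← hν', (hM π hπ).unique hνs hνs']

/-- The Poisson equation of a policy is stable in a unichain MDP. -/
lemma Unichain.exists_norm_le {M : FiniteMDP X A} (hM : M.Unichain) {π : X → A → ℝ}
    (hπ : IsPolicy π) (x₀ : X) :
    ∃ K : ℝ, 0 ≤ K ∧ ∀ h : X → ℝ, h x₀ = 0 → ‖h‖ ≤ K * ‖h - M.expect π h‖ := by
  let c : (X → ℝ) →ₗ[ℝ] (X → ℝ) := LinearMap.pi fun _ => LinearMap.proj x₀
  -- The rank-one term `c` removes the constants from the kernel of `id - M.expect π` and vanishes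
  -- on functions with `h x₀ = 0`.
  let L : (X → ℝ) →ₗ[ℝ] (X → ℝ) := LinearMap.id - M.expect π + c
  have hLa : ∀ h x, L h x = h x - M.expect π h x + h x₀ := fun h x => rfl
  have hker : LinearMap.ker L = ⊥ := by
    refine LinearMap.ker_eq_bot'.2 fun h hL => ?_
    obtain ⟨ν, hν, -⟩ := hM π hπ
    have hν := isStationaryDist_iff.1 hν
    -- Pairing with the stationary `ν` annihilates the `id - M.expect π` part.
    have h1 : ∑ x, ν x * L h x = h x₀ := by
      simp only [hLa, mul_add, mul_sub, Finset.sum_add_distrib, Finset.sum_sub_distrib,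
        ← sum_pushMeasure_mul, hν.2, ← Finset.sum_mul, hν.1.2]
      ring
    have h0 : h x₀ = 0 := by rw [← h1, hL]; simp
    have hh : M.expect π h = h := by
      ext x
      have := congrFun hL x
      rw [hLa, h0, Pi.zero_apply] at this
      linarith
    ext x
    rw [hM.harmonic_const hπ hh x x₀, h0, Pi.zero_apply]
  obtain ⟨K, -, hK⟩ := L.exists_antilipschitzWith hker
  refine ⟨K, K.2, fun h h0 => ?_⟩
  have := hK.le_mul_dist h 0
  have hL : L h = h - M.expect π h := by
    ext x
    rw [hLa, h0, add_zero, Pi.sub_apply]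
  rwa [map_zero, dist_zero_right, dist_zero_right, hL] at this

/-! ### The soft Bellman operator and the vanishing-discount limit. -/

/-- The soft Bellman operator. -/
noncomputable def softOp (M : FiniteMDP X A) (π' : X → A → ℝ) (η : ℝ) (V : X → ℝ) (x : X) : ℝ :=
  logPartition η (π' x) fun a => M.r x a + ∑ y, M.P x a y * V y

lemma softOp_add_const (M : FiniteMDP X A) {π' : X → A → ℝ} (hπ' : IsPolicy π') {η : ℝ}
    (hη : 0 < η) (V : X → ℝ) (c : ℝ) (x : X) :
    M.softOp π' η (fun y => V y + c) x = M.softOp π' η V x + c := by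
  unfold softOp
  rw [← logPartition_add_const hη (hπ' x)]
  congr 1
  ext a
  simp only [mul_add, Finset.sum_add_distrib, ← Finset.sum_mul, (M.P_mem x a).2, one_mul, add_assoc]

lemma softOp_mono (M : FiniteMDP X A) {π' : X → A → ℝ} (hπ' : IsPolicy π') {η : ℝ}
    (hη : 0 < η) {V W : X → ℝ} (h : ∀ y, V y ≤ W y) (x : X) :
    M.softOp π' η V x ≤ M.softOp π' η W x :=
  logPartition_mono hη (hπ' x) fun a _ => add_le_add_right
    (Finset.sum_le_sum fun y _ => mul_le_mul_of_nonneg_left (h y) ((M.P_mem x a).1 y)) _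

/-- A monotone operator that commutes with adding constants is nonexpansive in the sup norm, since
`V ≤ W + dist V W`. -/
lemma dist_softOp_le (M : FiniteMDP X A) {π' : X → A → ℝ} (hπ' : IsPolicy π') {η : ℝ}
    (hη : 0 < η) (V W : X → ℝ) : dist (M.softOp π' η V) (M.softOp π' η W) ≤ dist V W := by
  have key : ∀ V W : X → ℝ, ∀ x, M.softOp π' η V x ≤ M.softOp π' η W x + dist V W := by
    intro V W x
    rw [← M.softOp_add_const hπ' hη]
    refine M.softOp_mono hπ' hη (fun y => ?_) x
    have := dist_le_pi_dist V W y
    rw [Real.dist_eq] at this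
    linarith [le_abs_self (V y - W y)]
  refine (dist_pi_le_iff dist_nonneg).2 fun x => ?_
  rw [Real.dist_eq, abs_sub_le_iff]
  have h1 := key V W x
  have h2 := key W V x
  rw [dist_comm] at h2
  constructor <;> linarith

lemma softBellman_iff (M : FiniteMDP X A) {π' : X → A → ℝ} (hπ' : IsPolicy π') {η : ℝ}
    (hη : 0 < η) {V : X → ℝ} {lam : ℝ} :
    M.SoftBellman π' η V lam ↔ ∀ x, V x + lam = M.softOp π' η V x := by
  refine forall_congr' fun x => ?_
  have h := logPartition_add_const hη (hπ' x) (fun a => M.r x a + ∑ y, M.P x a y * V y) (-lam)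
  have h2 : (1 / η) * Real.log
      (∑ a, π' x a * Real.exp (η * (M.r x a - lam + ∑ y, M.P x a y * V y)))
      = M.softOp π' η V x - lam := by
    rw [softOp, sub_eq_add_neg _ lam, ← h, logPartition]
    congr 2
    refine Finset.sum_congr rfl fun a _ => ?_
    congr 3
    ring
  rw [h2, eq_sub_iff_add_eq]

/-- The discounted soft Bellman equation is solvable. -/
lemma exists_softOp_smul_eq (M : FiniteMDP X A) {π' : X → A → ℝ} (hπ' : IsPolicy π') {η : ℝ}
    (hη : 0 < η) {γ : ℝ} (h0 : 0 ≤ γ) (h1 : γ < 1) :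
    ∃ V : X → ℝ, M.softOp π' η (γ • V) = V := by
  have hc : ContractingWith ⟨γ, h0⟩ fun V : X → ℝ => M.softOp π' η (γ • V) := by
    refine ⟨h1, LipschitzWith.of_dist_le_mul fun V W => ?_⟩
    refine (M.dist_softOp_le hπ' hη _ _).trans ?_
    rw [dist_smul₀, Real.norm_of_nonneg h0]
    rfl
  exact ⟨_, hc.fixedPoint_isFixedPt⟩

/-- In a unichain MDP, the solutions of the discounted soft Bellman equations have uniformly
bounded oscillation. -/
lemma Unichain.exists_bound_discounted {M : FiniteMDP X A} (hM : M.Unichain)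
    {π' : X → A → ℝ} (hπ' : IsPolicy π') {η : ℝ} (hη : 0 < η) (x₀ : X) :
    ∃ B : ℝ, ∀ (γ : ℝ) (V : X → ℝ), 0 ≤ γ → γ < 1 → M.softOp π' η (γ • V) = V →
      ‖fun x => V x - V x₀‖ ≤ B ∧ |(1 - γ) * V x₀| ≤ B := by
  classical
  have hdet : ∀ f : X → A, IsPolicy fun x => (Pi.single (f x) 1 : A → ℝ) :=
    fun f x => single_mem_stdSimplex ℝ (f x)
  -- There are only finitely many deterministic policies, so the sum of their stability constants is
  -- a bound uniform in `γ`.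
  choose K hK0 hK using fun f : X → A => hM.exists_norm_le (hdet f) x₀
  set C₀ := ‖M.softOp π' η 0‖
  set C₁ := ∑ x, ((∑ a, |M.r x a|) + ∑ a, (1 / η) * |Real.log (π' x a)|)
  have hC₁x : ∀ x, (∑ a, |M.r x a|) + ∑ a, (1 / η) * |Real.log (π' x a)| ≤ C₁ := fun x =>
    Finset.single_le_sum
      (f := fun x => (∑ a, |M.r x a|) + ∑ a, (1 / η) * |Real.log (π' x a)|)
      (fun x _ => by positivity) (Finset.mem_univ x)
  have hC₁ : 0 ≤ C₁ := Finset.sum_nonneg fun x _ => by positivity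
  have hC₀ : 0 ≤ C₀ := norm_nonneg _
  have hKs : 0 ≤ ∑ f, K f := Finset.sum_nonneg fun f _ => hK0 f
  refine ⟨(∑ f, K f) * (C₁ + C₀) + C₀, fun γ V h0 h1 hV => ?_⟩
  have hnorm : (1 - γ) * ‖V‖ ≤ C₀ := by
    have h2 := M.dist_softOp_le hπ' hη (γ • V) 0
    rw [hV, dist_zero_right, norm_smul, Real.norm_of_nonneg h0] at h2
    have h3 := norm_le_norm_add_norm_sub' V (M.softOp π' η 0)
    rw [dist_eq_norm] at h2
    linarith
  have hVx : ∀ x, |(1 - γ) * V x| ≤ C₀ := fun x => by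
    rw [abs_mul, abs_of_pos (sub_pos.2 h1)]
    exact (mul_le_mul_of_nonneg_left (norm_le_pi_norm V x) (sub_pos.2 h1).le).trans hnorm
  refine ⟨?_, (hVx x₀).trans (by linarith [mul_nonneg hKs (add_nonneg hC₁ hC₀)])⟩
  -- The log-partition function is close to the payoff of one action. `C₁` absorbs both this error
  -- and the reward, and the chosen actions form a deterministic policy `f`.
  have hf : ∀ x, ∃ a, |V x - γ * ∑ y, M.P x a y * V y| ≤ C₁ := by
    intro x
    obtain ⟨a, ha⟩ := exists_abs_logPartition_sub_le hη (hπ' x)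
      fun a => M.r x a + ∑ y, M.P x a y * (γ • V) y
    have hVe : logPartition η (π' x) (fun a => M.r x a + ∑ y, M.P x a y * (γ • V) y) = V x :=
      congrFun hV x
    have hs : ∑ y, M.P x a y * (γ • V) y = γ * ∑ y, M.P x a y * V y := by
      rw [Finset.mul_sum]
      exact Finset.sum_congr rfl fun y _ => by simp only [Pi.smul_apply, smul_eq_mul]; ring
    rw [hVe, hs] at ha
    have hr : |M.r x a| ≤ ∑ a, |M.r x a| :=
      Finset.single_le_sum (f := fun a => |M.r x a|) (fun a _ => abs_nonneg _)
        (Finset.mem_univ a)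
    refine ⟨a, ?_⟩
    have h2 := abs_add_le (V x - (M.r x a + γ * ∑ y, M.P x a y * V y)) (M.r x a)
    rw [show V x - (M.r x a + γ * ∑ y, M.P x a y * V y) + M.r x a
      = V x - γ * ∑ y, M.P x a y * V y by ring] at h2
    linarith [hC₁x x]
  choose f hf using hf
  have hE : ∀ h : X → ℝ, ∀ x, M.expect (fun x => Pi.single (f x) 1) h x
      = ∑ y, M.P x (f x) y * h y := fun h x => by
    simp [expect_apply, Pi.single_apply]
  have hb := hK f (fun x => V x - V x₀) (sub_self _)
  -- The Poisson residual is `(V - γ P V) - (1 - γ) P V`, whose parts are bounded by `C₁` and `C₀`.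
  have hP : ‖(fun x => V x - V x₀) - M.expect (fun x => Pi.single (f x) 1)
      (fun x => V x - V x₀)‖ ≤ C₁ + C₀ := by
    refine (pi_norm_le_iff_of_nonneg (by linarith)).2 fun x => ?_
    have hPV : |(1 - γ) * ∑ y, M.P x (f x) y * V y| ≤ C₀ := by
      rw [Finset.mul_sum]
      refine (Finset.abs_sum_le_sum_abs _ _).trans ?_
      calc ∑ y, |(1 - γ) * (M.P x (f x) y * V y)|
          ≤ ∑ y, M.P x (f x) y * C₀ := Finset.sum_le_sum fun y _ => by
            rw [show (1 - γ) * (M.P x (f x) y * V y) = M.P x (f x) y * ((1 - γ) * V y) by ring,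
              abs_mul, abs_of_nonneg ((M.P_mem x (f x)).1 y)]
            exact mul_le_mul_of_nonneg_left (hVx y) ((M.P_mem x (f x)).1 y)
        _ = C₀ := by rw [← Finset.sum_mul, (M.P_mem x (f x)).2, one_mul]
    rw [Real.norm_eq_abs, Pi.sub_apply, hE]
    simp only [mul_sub, Finset.sum_sub_distrib, ← Finset.sum_mul, (M.P_mem x (f x)).2, one_mul]
    have h2 := abs_sub (V x - γ * ∑ y, M.P x (f x) y * V y) ((1 - γ) * ∑ y, M.P x (f x) y * V y)
    rw [show V x - γ * ∑ y, M.P x (f x) y * V y - (1 - γ) * ∑ y, M.P x (f x) y * V y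
      = V x - V x₀ - (∑ y, M.P x (f x) y * V y - V x₀) by ring] at h2
    linarith [hf x]
  calc ‖fun x => V x - V x₀‖ ≤ K f * (C₁ + C₀) :=
        hb.trans (mul_le_mul_of_nonneg_left hP (hK0 f))
    _ ≤ (∑ f, K f) * (C₁ + C₀) := mul_le_mul_of_nonneg_right
        (Finset.single_le_sum (f := K) (fun f _ => hK0 f) (Finset.mem_univ f)) (by linarith)
    _ ≤ _ := by linarith

/-- In a unichain MDP, the average-reward soft Bellman equations are solvable. -/
lemma Unichain.exists_softBellman [Nonempty X] {M : FiniteMDP X A} (hM : M.Unichain)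
    {π' : X → A → ℝ} (hπ' : IsPolicy π') {η : ℝ} (hη : 0 < η) :
    ∃ (V : X → ℝ) (lam : ℝ), M.SoftBellman π' η V lam := by
  obtain ⟨x₀⟩ := ‹Nonempty X›
  obtain ⟨B, hB⟩ := hM.exists_bound_discounted hπ' hη x₀
  let γ : ℕ → ℝ := fun n => 1 - 1 / ((n : ℝ) + 1)
  have hγ0 : ∀ n, 0 ≤ γ n := fun n => sub_nonneg.2 <| by
    rw [div_le_one (by positivity)]
    linarith [(Nat.cast_nonneg n : (0 : ℝ) ≤ n)]
  have hγ1 : ∀ n, γ n < 1 := fun n => sub_lt_self _ (by positivity)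
  have hγ : Tendsto γ atTop (𝓝 1) := by
    have h := (tendsto_const_nhds (x := (1 : ℝ))).sub
      (tendsto_one_div_add_atTop_nhds_zero_nat (𝕜 := ℝ))
    rwa [sub_zero] at h
  choose V hV using fun n => M.exists_softOp_smul_eq hπ' hη (hγ0 n) (hγ1 n)
  -- Discounted values may blow up as `γ` tends to `1`; relative values and `(1 - γ) V(x₀)` stay
  -- bounded, and their limits give `V` and `lam`.
  let u : ℕ → (X → ℝ) × ℝ := fun n => (fun x => V n x - V n x₀, (1 - γ n) * V n x₀)
  have hu : ∀ n, u n ∈ Metric.closedBall (0 : (X → ℝ) × ℝ) B := fun n => by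
    obtain ⟨h1, h2⟩ := hB (γ n) (V n) (hγ0 n) (hγ1 n) (hV n)
    rw [mem_closedBall_zero_iff, Prod.norm_def]
    exact max_le h1 h2
  obtain ⟨⟨h, lam⟩, -, φ, hφ, hlim⟩ := tendsto_subseq_of_bounded Metric.isBounded_closedBall hu
  refine ⟨h, lam, (M.softBellman_iff hπ' hη).2 fun x => ?_⟩
  have hlim1 : Tendsto (fun n => (u (φ n)).1) atTop (𝓝 h) :=
    (continuous_fst.tendsto (h, lam)).comp hlim
  have hlim2 : Tendsto (fun n => (u (φ n)).2) atTop (𝓝 lam) :=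
    (continuous_snd.tendsto (h, lam)).comp hlim
  have hcont : Continuous (M.softOp π' η) :=
    (LipschitzWith.of_dist_le_mul (K := 1) fun V W => by
      simpa using M.dist_softOp_le hπ' hη V W).continuous
  have hR := (((continuous_apply x).comp hcont).tendsto _).comp
    ((hγ.comp hφ.tendsto_atTop).smul hlim1)
  have hL := ((tendsto_pi_nhds.1 hlim1) x).add hlim2
  rw [one_smul] at hR
  -- Pulling the constant `γ V(x₀)` out of the operator turns the discounted equation into `u.1 x +
  -- u.2 = softOp (γ • u.1) x`.
  refine tendsto_nhds_unique hL (hR.congr fun n => ?_)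
  have h1 := congrFun (hV (φ n)) x
  have h2 := M.softOp_add_const hπ' hη (γ (φ n) • (u (φ n)).1) (γ (φ n) * V (φ n) x₀) x
  have h3 : (fun y => (γ (φ n) • (u (φ n)).1) y + γ (φ n) * V (φ n) x₀) = γ (φ n) • V (φ n) := by
    ext y
    simp only [u, Pi.smul_apply, smul_eq_mul]
    ring
  rw [h3, h1] at h2
  simp only [Function.comp]
  simp only [u] at h2 ⊢
  linarith

end FiniteMDP

/-! ### The Lagrangian as a sum of free energies. -/

namespace FiniteMDP

section

variable {X A : Type*} [Fintype A]

/-- The state-action measure with given state marginal that follows the Gibbs policy of `g`. -/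
noncomputable def gibbsMeasure (π' : X → A → ℝ) (η : ℝ) (g : X → A → ℝ) (ν : X → ℝ)
    (p : X × A) : ℝ :=
  ν p.1 * gibbs η (π' p.1) (g p.1) p.2

lemma stateMarginal_gibbsMeasure {π' : X → A → ℝ} (hπ' : IsPolicy π') (η : ℝ)
    (g : X → A → ℝ) (ν : X → ℝ) (x : X) :
    stateMarginal (gibbsMeasure π' η g ν) x = ν x := by
  simp only [stateMarginal, gibbsMeasure, ← Finset.mul_sum,
    (gibbs_mem_stdSimplex (hπ' x) _).2, mul_one]

lemma gibbsMeasure_mem_condDivDomain {π' : X → A → ℝ} (hπ' : IsPolicy π') (η : ℝ)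
    (g : X → A → ℝ) {ν : X → ℝ} (hν : ∀ x, 0 ≤ ν x) :
    gibbsMeasure π' η g ν ∈ condDivDomain π' :=
  ⟨fun p => mul_nonneg (hν _) ((gibbs_mem_stdSimplex (hπ' _) _).1 _),
    fun x a h => by simp [gibbsMeasure, gibbs, h]⟩

lemma stateMarginal_nonneg {μ : X × A → ℝ} (hμ : ∀ p, 0 ≤ μ p) (x : X) :
    0 ≤ stateMarginal μ x :=
  Finset.sum_nonneg fun a _ => hμ (x, a)

lemma eq_zero_of_stateMarginal_eq_zero {μ : X × A → ℝ} (hμ : ∀ p, 0 ≤ μ p) {x : X}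
    (h : stateMarginal μ x = 0) (a : A) : μ (x, a) = 0 :=
  (Finset.sum_eq_zero_iff_of_nonneg fun b _ => hμ (x, b)).1 h a (Finset.mem_univ a)

end

variable {X A : Type*} [Fintype X] [Fintype A]

lemma lagrangian_eq (M : FiniteMDP X A) (π' : X → A → ℝ) (η : ℝ) (V : X → ℝ) (lam : ℝ)
    (φ μ : X × A → ℝ) :
    M.lagrangian π' η V lam φ μ = lam + ∑ x, freeEnergy η (π' x)
      (fun a => M.advantage V x a - lam + φ (x, a)) fun a => μ (x, a) := by
  have h1 : ∑ y, V y * (∑ x, ∑ a, M.P x a y * μ (x, a) - ∑ b, μ (y, b))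
      = ∑ x, ∑ a, μ (x, a) * (∑ y, M.P x a y * V y - V x) := by
    have h2 : ∑ y, V y * ∑ x, ∑ a, M.P x a y * μ (x, a)
        = ∑ x, ∑ a, μ (x, a) * ∑ y, M.P x a y * V y := by
      simp only [Finset.mul_sum]
      rw [Finset.sum_comm]
      refine Finset.sum_congr rfl fun x _ => ?_
      rw [Finset.sum_comm]
      exact Finset.sum_congr rfl fun a _ => Finset.sum_congr rfl fun y _ => by ring
    simp only [mul_sub, Finset.sum_sub_distrib]
    rw [h2, Finset.sum_congr rfl fun y _ => Finset.mul_sum _ _ (V y)]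
    simp only [mul_comm (V _)]
  have h3 : ∀ x, freeEnergy η (π' x) (fun a => M.advantage V x a - lam + φ (x, a))
      (fun a => μ (x, a)) = ∑ a, μ (x, a) * M.r x a
        + ∑ a, μ (x, a) * (∑ y, M.P x a y * V y - V x)
        - lam * ∑ a, μ (x, a) + ∑ a, φ (x, a) * μ (x, a)
        - (1 / η) * ∑ a, μ (x, a) * Real.log (inducedPolicy μ x a / π' x a) := by
    intro x
    unfold freeEnergy
    congr 1
    rw [Finset.mul_sum, ← Finset.sum_add_distrib, ← Finset.sum_sub_distrib,
      ← Finset.sum_add_distrib]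
    refine Finset.sum_congr rfl fun a _ => ?_
    unfold advantage
    ring
  simp only [lagrangian, regReward, condDiv, h1, h3, Finset.sum_add_distrib,
    Finset.sum_sub_distrib, ← Finset.mul_sum]
  ring

lemma sum_freeEnergy_gibbsMeasure {π' : X → A → ℝ} (hπ' : IsPolicy π') {η : ℝ} (hη : 0 < η)
    (g : X → A → ℝ) {ν : X → ℝ} (hν : ∀ x, 0 ≤ ν x) :
    ∑ x, freeEnergy η (π' x) (g x) (fun a => gibbsMeasure π' η g ν (x, a))
      = ∑ x, ν x * logPartition η (π' x) (g x) := by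
  have hD := gibbsMeasure_mem_condDivDomain hπ' η g hν
  have hm := stateMarginal_gibbsMeasure hπ' η g ν
  unfold stateMarginal at hm
  refine Finset.sum_congr rfl fun x _ => ?_
  rw [(freeEnergy_eq_iff hη (hπ' x) _ (fun a => hD.1 _) (hD.2 x)).2 fun a => ?_, hm]
  rw [hm, gibbsMeasure]

/-- If `μ` maximizes the total free energy and charges every state, then all log-partition
functions vanish and `μ` charges every action in the support of `π'`. -/
lemma logPartition_eq_zero_of_isMaxOn {π' : X → A → ℝ} (hπ' : IsPolicy π') {η : ℝ} (hη : 0 < η)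
    {g : X → A → ℝ} {μ : X × A → ℝ} (hμ : μ ∈ condDivDomain π')
    (hpos : ∀ x, 0 < stateMarginal μ x)
    (hmax : IsMaxOn (fun μ : X × A → ℝ =>
      ∑ x, freeEnergy η (π' x) (g x) fun a => μ (x, a)) (condDivDomain π') μ) (x : X) :
    logPartition η (π' x) (g x) = 0 ∧ ∀ a, π' x a ≠ 0 → 0 < μ (x, a) := by
  classical
  have hle : ∀ x ∈ Finset.univ, freeEnergy η (π' x) (g x) (fun a => μ (x, a))
      ≤ stateMarginal μ x * logPartition η (π' x) (g x) := fun x _ =>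
    freeEnergy_le hη (hπ' x) _ (fun a => hμ.1 _) (hμ.2 x)
  have hcmp : ∀ ν : X → ℝ, (∀ x, 0 ≤ ν x) → ∑ x, ν x * logPartition η (π' x) (g x)
      ≤ ∑ x, freeEnergy η (π' x) (g x) fun a => μ (x, a) := fun ν hν => by
    rw [← sum_freeEnergy_gibbsMeasure hπ' hη g hν]
    exact hmax (gibbsMeasure_mem_condDivDomain hπ' η g hν)
  have hsum := Finset.sum_le_sum hle
  -- Change the mass at `x` by `t` and use the Gibbs policy everywhere: the total is linear in the
  -- state masses, so a maximizer with positive masses forces zero slope.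
  have hpert : ∀ t : ℝ, 0 ≤ stateMarginal μ x + t → t * logPartition η (π' x) (g x) ≤ 0 := by
    intro t ht
    have h := hcmp (fun z => stateMarginal μ z + if z = x then t else 0) fun z => by
      split_ifs with hz
      · exact hz ▸ ht
      · simpa using (hpos z).le
    simp only [add_mul, Finset.sum_add_distrib, ite_mul, zero_mul, Finset.sum_ite_eq',
      Finset.mem_univ, if_true] at h
    linarith
  have hx := hpos x
  constructor
  · refine le_antisymm (by simpa using hpert 1 (by linarith)) ?_
    have := hpert (-stateMarginal μ x) (by linarith)
    exact nonneg_of_mul_nonneg_right (by linarith) hx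
  · have heq := (Finset.sum_eq_sum_iff_of_le hle).1
      (le_antisymm hsum (hcmp _ fun z => (hpos z).le)) x (Finset.mem_univ x)
    intro a ha
    rw [(freeEnergy_eq_iff hη (hπ' x) _ (fun a => hμ.1 _) (hμ.2 x)).1 heq a]
    exact mul_pos hx (gibbs_pos (hπ' x) _ ha)

lemma softBellman_iff_logPartition (M : FiniteMDP X A) {π' : X → A → ℝ} (hπ' : IsPolicy π')
    {η : ℝ} (hη : 0 < η) {V : X → ℝ} {lam : ℝ} :
    M.SoftBellman π' η V lam
      ↔ ∀ x, logPartition η (π' x) (fun a => M.advantage V x a - lam) = 0 := by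
  rw [M.softBellman_iff hπ' hη]
  refine forall_congr' fun x => ?_
  have h := logPartition_add_const hη (hπ' x) (fun a => M.r x a + ∑ y, M.P x a y * V y)
    (-V x - lam)
  have h2 : (fun a => M.advantage V x a - lam)
      = fun a => M.r x a + ∑ y, M.P x a y * V y + (-V x - lam) := by
    ext a
    unfold advantage
    ring
  rw [h2, h, softOp]
  constructor <;> intro h <;> linarith

lemma softPolicy_eq_gibbs (M : FiniteMDP X A) (π' : X → A → ℝ) (η : ℝ) (V : X → ℝ) (lam : ℝ)
    (x : X) : M.softPolicy π' η V x = gibbs η (π' x) fun a => M.advantage V x a - lam := by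
  rw [show (fun a => M.advantage V x a - lam) = fun a => M.advantage V x a + -lam from rfl,
    gibbs_add_const]
  rfl

lemma softPolicy_isPolicy (M : FiniteMDP X A) {π' : X → A → ℝ} (hπ' : IsPolicy π')
    (η : ℝ) (V : X → ℝ) : IsPolicy (M.softPolicy π' η V) :=
  fun x => gibbs_mem_stdSimplex (hπ' x) _

lemma lagrangian_zero_eq (M : FiniteMDP X A) (π' : X → A → ℝ) (η : ℝ) (V : X → ℝ) (lam : ℝ)
    (μ : X × A → ℝ) :
    M.lagrangian π' η V lam 0 μ = lam + ∑ x, freeEnergy η (π' x)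
      (fun a => M.advantage V x a - lam) fun a => μ (x, a) := by
  simp [lagrangian_eq]

lemma SoftBellman.lagrangian_le {M : FiniteMDP X A} {π' : X → A → ℝ} (hπ' : IsPolicy π')
    {η : ℝ} (hη : 0 < η) {V : X → ℝ} {lam : ℝ} (h : M.SoftBellman π' η V lam)
    {μ : X × A → ℝ} (hμ : μ ∈ condDivDomain π') : M.lagrangian π' η V lam 0 μ ≤ lam := by
  rw [lagrangian_zero_eq]
  refine add_le_of_nonpos_right (Finset.sum_nonpos fun x _ => ?_)
  refine (freeEnergy_le hη (hπ' x) _ (fun a => hμ.1 _) (hμ.2 x)).trans ?_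
  rw [(M.softBellman_iff_logPartition hπ' hη).1 h x, mul_zero]

lemma SoftBellman.lagrangian_eq_iff {M : FiniteMDP X A} {π' : X → A → ℝ} (hπ' : IsPolicy π')
    {η : ℝ} (hη : 0 < η) {V : X → ℝ} {lam : ℝ} (h : M.SoftBellman π' η V lam)
    {μ : X × A → ℝ} (hμ : μ ∈ condDivDomain π') :
    M.lagrangian π' η V lam 0 μ = lam
      ↔ ∀ x a, μ (x, a) = stateMarginal μ x * M.softPolicy π' η V x a := by
  have hz := (M.softBellman_iff_logPartition hπ' hη).1 h
  have hle : ∀ x ∈ Finset.univ, freeEnergy η (π' x) (fun a => M.advantage V x a - lam)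
      (fun a => μ (x, a)) ≤ 0 := fun x _ => by
    refine (freeEnergy_le hη (hπ' x) _ (fun a => hμ.1 _) (hμ.2 x)).trans ?_
    rw [hz x, mul_zero]
  rw [lagrangian_zero_eq, add_eq_left, Finset.sum_eq_zero_iff_of_nonpos hle]
  simp only [Finset.mem_univ, true_implies]
  refine forall_congr' fun x => ?_
  have := freeEnergy_eq_iff hη (hπ' x) (fun a => M.advantage V x a - lam)
    (q := fun a => μ (x, a)) (fun a => hμ.1 _) (hμ.2 x)
  rw [hz x, mul_zero] at this
  rw [this, M.softPolicy_eq_gibbs π' η V lam]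
  rfl

/-- The soft Bellman equations characterize the multipliers for which the Lagrangian has a
complementary maximizer that charges every state. -/
lemma softBellman_iff_exists_isMaxOn (M : FiniteMDP X A) {π' : X → A → ℝ} (hπ' : IsPolicy π')
    {η : ℝ} (hη : 0 < η) (V : X → ℝ) (lam : ℝ) :
    M.SoftBellman π' η V lam ↔
      ∃ (φ : X × A → ℝ) (μ : X × A → ℝ), (∀ p, 0 ≤ φ p) ∧ μ ∈ condDivDomain π' ∧
        (∀ x, 0 < stateMarginal μ x) ∧ (∀ p, φ p * μ p = 0) ∧
        IsMaxOn (M.lagrangian π' η V lam φ) (condDivDomain π') μ := by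
  constructor
  · intro h
    let g : X → A → ℝ := fun x a => M.advantage V x a - lam
    have hD := gibbsMeasure_mem_condDivDomain hπ' η g (ν := fun _ => 1) fun _ => zero_le_one
    have hm := stateMarginal_gibbsMeasure hπ' η g fun _ => 1
    -- Unit mass at every state is admissible because the domain imposes no normalization.
    refine ⟨0, gibbsMeasure π' η g fun _ => 1, fun _ => le_rfl, hD, fun x => by simp [hm],
      fun p => by simp, fun μ hμ => ?_⟩
    refine (h.lagrangian_le hπ' hη hμ).trans_eq
      ((h.lagrangian_eq_iff hπ' hη hD).2 fun x a => ?_).symm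
    rw [hm, M.softPolicy_eq_gibbs π' η V lam]
    rfl
  · rintro ⟨φ, μ, -, hμ, hpos, hcomp, hmax⟩
    have hmax' : IsMaxOn (fun μ : X × A → ℝ => ∑ x, freeEnergy η (π' x)
        (fun a => M.advantage V x a - lam + φ (x, a)) fun a => μ (x, a)) (condDivDomain π') μ := by
      intro μ₁ hμ₁
      have := hmax hμ₁
      simp only [Set.mem_ofPred_eq, lagrangian_eq] at this ⊢
      linarith
    rw [M.softBellman_iff_logPartition hπ' hη]
    intro x
    obtain ⟨h0, hp⟩ := logPartition_eq_zero_of_isMaxOn hπ' hη hμ hpos hmax' x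
    rw [← h0]
    refine logPartition_congr fun a ha => ?_
    -- Complementarity removes `φ` only on the support of `π'`, which is all that the log-partition
    -- function sees.
    rw [(mul_eq_zero.1 (hcomp (x, a))).resolve_right (hp a ha).ne', add_zero]

lemma SoftBellman.dualFunction_eq {M : FiniteMDP X A} {π' : X → A → ℝ} (hπ' : IsPolicy π')
    {η : ℝ} (hη : 0 < η) {V : X → ℝ} {lam : ℝ} (h : M.SoftBellman π' η V lam) :
    M.dualFunction π' η V lam 0 = (lam : EReal) := by
  refine le_antisymm (iSup₂_le fun μ hμ => EReal.coe_le_coe_iff.2 (h.lagrangian_le hπ' hη hμ)) ?_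
  have h0 : (0 : X × A → ℝ) ∈ condDivDomain π' := ⟨fun _ => le_rfl, fun _ _ _ => rfl⟩
  -- The zero measure already attains the bound `lam`.
  refine le_iSup₂_of_le 0 h0 (EReal.coe_le_coe_iff.2 (Eq.ge ?_))
  rw [h.lagrangian_eq_iff hπ' hη h0]
  simp [stateMarginal]

/-! ### Stationary state-action distributions and the domain of the regularizer. -/

lemma mem_stationarySet_of_isStationaryDist {M : FiniteMDP X A} {π : X → A → ℝ}
    (hπ : IsPolicy π) {ν : X → ℝ} (hν : M.IsStationaryDist π ν) :
    (fun p : X × A => ν p.1 * π p.1 p.2) ∈ M.stationarySet := by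
  refine ⟨⟨fun p => mul_nonneg (hν.1.1 _) ((hπ _).1 _), ?_⟩, fun y => ?_⟩
  · simp only [Fintype.sum_prod_type, ← Finset.mul_sum, (hπ _).2, mul_one, hν.1.2]
  · simp only [← Finset.mul_sum, (hπ _).2, mul_one]
    rw [hν.2 y]
    exact Finset.sum_congr rfl fun x _ => Finset.sum_congr rfl fun a _ => by ring

lemma isStationaryDist_stateMarginal {M : FiniteMDP X A} {μ : X × A → ℝ}
    (hμ : μ ∈ M.stationarySet) {π : X → A → ℝ}
    (h : ∀ x a, μ (x, a) = stateMarginal μ x * π x a) :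
    M.IsStationaryDist π (stateMarginal μ) := by
  refine ⟨⟨fun x => Finset.sum_nonneg fun a _ => hμ.1.1 _, ?_⟩, fun y => ?_⟩
  · have := hμ.1.2
    rwa [Fintype.sum_prod_type] at this
  · refine (hμ.2 y).trans ?_
    refine Finset.sum_congr rfl fun x _ => Finset.sum_congr rfl fun a _ => ?_
    rw [h x a]
    ring

/-- In a unichain MDP, a stationary state-action distribution whose policy has full support
dominates all others. -/
lemma Unichain.stationarySet_subset_condDivDomain {M : FiniteMDP X A} (hM : M.Unichain)
    {μ' : X × A → ℝ} (hμ' : μ' ∈ M.stationarySet) {π' : X → A → ℝ}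
    (hπ' : IsConditionalPolicy μ' π')
    (hfull : ∀ x, 0 < stateMarginal μ' x → ∀ a, 0 < π' x a) :
    M.stationarySet ⊆ condDivDomain π' := by
  classical
  intro μ hμ
  have hν' := isStationaryDist_stateMarginal hμ' hπ'.2
  have hnn' := stateMarginal_nonneg hμ'.1.1
  have hnn := stateMarginal_nonneg hμ.1.1
  -- No action leaves the support of `ν_μ'`: stationarity makes the inflow into a null state vanish,
  -- and `π'` plays every action on the support.
  have hclosed : ∀ x a y, 0 < stateMarginal μ' x → stateMarginal μ' y = 0 → M.P x a y = 0 := by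
    intro x a y hx hy
    have hterm : ∀ x a, 0 ≤ M.P x a y * π' x a * stateMarginal μ' x := fun x a =>
      mul_nonneg (mul_nonneg ((M.P_mem x a).1 y) ((hπ'.1 x).1 a)) (hnn' x)
    have h := hν'.2 y
    rw [hy, eq_comm, Finset.sum_eq_zero_iff_of_nonneg
      fun x _ => Finset.sum_nonneg fun a _ => hterm x a] at h
    have h := (Finset.sum_eq_zero_iff_of_nonneg fun a _ => hterm x a).1
      (h x (Finset.mem_univ x)) a (Finset.mem_univ a)
    rw [mul_eq_zero, or_iff_left hx.ne', mul_eq_zero, or_iff_left (hfull x hx a).ne'] at h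
    exact h
  let π : X → A → ℝ := fun x => if stateMarginal μ x = 0 then π' x else inducedPolicy μ x
  have hπ : IsPolicy π := by
    intro x
    by_cases hx : stateMarginal μ x = 0
    · simpa [π, hx] using hπ'.1 x
    · simp only [π, hx, if_false]
      exact ⟨fun a => div_nonneg (hμ.1.1 _) (hnn x), by
        simp only [inducedPolicy, ← Finset.sum_div]
        exact div_self hx⟩
  have hμπ : ∀ x a, μ (x, a) = stateMarginal μ x * π x a := by
    intro x a
    by_cases hx : stateMarginal μ x = 0
    · rw [hx, zero_mul, eq_zero_of_stateMarginal_eq_zero hμ.1.1 hx]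
    · simp only [π, hx, if_false, inducedPolicy]
      field_simp
  have hν := isStationaryDist_stateMarginal hμ hμπ
  -- The closed class also carries a stationary distribution of `π`; by uniqueness it is `ν_μ`.
  have hK : ∃ ν ∈ {ν : X → ℝ | ∀ x, stateMarginal μ' x = 0 → ν x = 0},
      M.IsStationaryDist π ν := by
    refine M.exists_isStationaryDist_mem hπ ?_ ?_ ⟨stateMarginal μ', hν'.1, fun x hx => hx⟩ ?_
    · simp only [Set.ofPred_forall]
      exact isClosed_iInter fun x => isClosed_iInter fun _ =>
        isClosed_eq (continuous_apply x) continuous_const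
    · intro ν hν ν₁ hν₁ s t _ _ _ x hx
      simp [hν x hx, hν₁ x hx]
    · intro ν _ hν y hy
      refine Finset.sum_eq_zero fun x _ => Finset.sum_eq_zero fun a _ => ?_
      by_cases hx : stateMarginal μ' x = 0
      · rw [hν x hx, mul_zero]
      · rw [hclosed x a y ((hnn' x).lt_of_ne' hx) hy, zero_mul, zero_mul]
  obtain ⟨ν, hνK, hνs⟩ := hK
  refine ⟨hμ.1.1, fun x a hxa => eq_zero_of_stateMarginal_eq_zero hμ.1.1 ?_ a⟩
  rw [(hM π hπ).unique hν hνs]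
  refine hνK x (by_contra fun hx => ?_)
  exact (hfull x ((hnn' x).lt_of_ne' hx) a).ne' hxa

/-! ### Strong duality and the optimal policy. -/

lemma lagrangian_of_mem_stationarySet {M : FiniteMDP X A} (π' : X → A → ℝ) (η : ℝ)
    (V : X → ℝ) (lam : ℝ) (φ : X × A → ℝ) {μ : X × A → ℝ} (hμ : μ ∈ M.stationarySet) :
    M.lagrangian π' η V lam φ μ = M.regReward π' η μ + ∑ x, ∑ a, φ (x, a) * μ (x, a) := by
  have h1 : ∑ x, ∑ a, μ (x, a) = 1 := by
    have := hμ.1.2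
    rwa [Fintype.sum_prod_type] at this
  have h2 : ∀ y, ∑ x, ∑ a, M.P x a y * μ (x, a) - ∑ b, μ (y, b) = 0 := fun y => by
    rw [hμ.2 y, sub_self]
  simp [lagrangian, h1, h2]

lemma lagrangian_zero_of_mem_stationarySet {M : FiniteMDP X A} (π' : X → A → ℝ) (η : ℝ)
    (V : X → ℝ) (lam : ℝ) {μ : X × A → ℝ} (hμ : μ ∈ M.stationarySet) :
    M.lagrangian π' η V lam 0 μ = M.regReward π' η μ := by
  simp [lagrangian_of_mem_stationarySet π' η V lam 0 hμ]

/-- A solution of the soft Bellman equations yields the optimal value of the primal program. -/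
lemma SoftBellman.isGreatest {M : FiniteMDP X A} (hM : M.Unichain) {π' : X → A → ℝ}
    (hπ' : IsPolicy π') (hsub : M.stationarySet ⊆ condDivDomain π')
    {η : ℝ} (hη : 0 < η) {V : X → ℝ} {lam : ℝ} (h : M.SoftBellman π' η V lam) :
    IsGreatest (M.regReward π' η '' M.stationarySet) lam := by
  constructor
  -- The stationary state-action distribution of the soft policy attains the bound.
  · have hπ := M.softPolicy_isPolicy hπ' η V
    obtain ⟨ν, hν, -⟩ := hM _ hπ
    have hμ := mem_stationarySet_of_isStationaryDist hπ hν
    refine ⟨_, hμ, ?_⟩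
    rw [← lagrangian_zero_of_mem_stationarySet π' η V lam hμ,
      h.lagrangian_eq_iff hπ' hη (hsub hμ)]
    intro x a
    simp only [stateMarginal, ← Finset.mul_sum, (hπ x).2, mul_one]
  · rintro _ ⟨μ, hμ, rfl⟩
    rw [← lagrangian_zero_of_mem_stationarySet π' η V lam hμ]
    exact h.lagrangian_le hπ' hη (hsub hμ)

/-- Weak duality. -/
lemma regReward_le_dualFunction {M : FiniteMDP X A} {π' : X → A → ℝ} (η : ℝ) (V : X → ℝ)
    (lam : ℝ) {φ : X × A → ℝ} (hφ : ∀ p, 0 ≤ φ p) {μ : X × A → ℝ}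
    (hμ : μ ∈ M.stationarySet) (hμD : μ ∈ condDivDomain π') :
    ((M.regReward π' η μ : ℝ) : EReal) ≤ M.dualFunction π' η V lam φ := by
  refine le_iSup₂_of_le μ hμD (EReal.coe_le_coe_iff.2 ?_)
  rw [lagrangian_of_mem_stationarySet π' η V lam φ hμ]
  exact le_add_of_nonneg_right (Finset.sum_nonneg fun x _ => Finset.sum_nonneg fun a _ =>
    mul_nonneg (hφ _) (hμ.1.1 _))

/-- The maximizers of the primal program are the stationary distributions of the soft policy. -/
lemma SoftBellman.isMaxOn_iff {M : FiniteMDP X A} (hM : M.Unichain) {π' : X → A → ℝ}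
    (hπ' : IsPolicy π') (hsub : M.stationarySet ⊆ condDivDomain π')
    {η : ℝ} (hη : 0 < η) {V : X → ℝ} {lam : ℝ} (h : M.SoftBellman π' η V lam)
    {μ : X × A → ℝ} (hμ : μ ∈ M.stationarySet) :
    IsMaxOn (M.regReward π' η) M.stationarySet μ ↔
      ∀ x, 0 < stateMarginal μ x → ∀ a, inducedPolicy μ x a = M.softPolicy π' η V x a := by
  have hg := h.isGreatest hM hπ' hsub hη
  have h1 : IsMaxOn (M.regReward π' η) M.stationarySet μ ↔ M.regReward π' η μ = lam := by
    constructor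
    · intro hmax
      obtain ⟨μ₁, hμ₁, he⟩ := hg.1
      exact le_antisymm (hg.2 ⟨μ, hμ, rfl⟩) (he ▸ hmax hμ₁)
    · intro he μ₁ hμ₁
      exact (hg.2 ⟨μ₁, hμ₁, rfl⟩).trans_eq he.symm
  rw [h1, ← lagrangian_zero_of_mem_stationarySet π' η V lam hμ,
    h.lagrangian_eq_iff hπ' hη (hsub hμ)]
  refine forall_congr' fun x => ?_
  rcases (stateMarginal_nonneg hμ.1.1 x).eq_or_lt with hx | hx
  · simp [← hx, eq_zero_of_stateMarginal_eq_zero hμ.1.1 hx.symm]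
  · simp only [hx, true_implies]
    refine forall_congr' fun a => ?_
    rw [inducedPolicy, div_eq_iff hx.ne', mul_comm]

end FiniteMDP

theorem proposition2 {X A : Type*} [Fintype X] [Fintype A]
    (M : FiniteMDP X A) (hM : M.Unichain)
    (η : ℝ) (hη : 0 < η)
    (μ' : X × A → ℝ) (hμ' : μ' ∈ M.stationarySet)
    (π' : X → A → ℝ) (hπ' : IsConditionalPolicy μ' π')
    (hfull : ∀ x, 0 < stateMarginal μ' x → ∀ a, 0 < π' x a) :
    -- The constraint set of the dual: the soft Bellman equations hold at `(V, lam)` exactly when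
    -- the Lagrangian has, for some `φ ≥ 0`, a maximizer charging every state and complementary
    -- to `φ`.
    (∀ (V : X → ℝ) (lam : ℝ), M.SoftBellman π' η V lam ↔
      ∃ (φ : X × A → ℝ) (μ : X × A → ℝ), (∀ p, 0 ≤ φ p) ∧ μ ∈ condDivDomain π' ∧
        (∀ x, 0 < stateMarginal μ x) ∧ (∀ p, φ p * μ p = 0) ∧
        IsMaxOn (M.lagrangian π' η V lam φ) (condDivDomain π') μ) ∧
    -- The objective of the dual: under these constraints the dual function equals `lam`.
    (∀ (V : X → ℝ) (lam : ℝ), M.SoftBellman π' η V lam →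
      M.dualFunction π' η V lam 0 = (lam : EReal)) ∧
    -- Strong duality, with all optima attained, and the form of the optimal policy.
    ∃ ρ : ℝ,
      IsGreatest (M.regReward π' η '' M.stationarySet) ρ ∧
      IsLeast {lam : ℝ | ∃ V : X → ℝ, M.SoftBellman π' η V lam} ρ ∧
      IsLeast {g : EReal | ∃ (V : X → ℝ) (lam : ℝ) (φ : X × A → ℝ), (∀ p, 0 ≤ φ p) ∧
        g = M.dualFunction π' η V lam φ} (ρ : EReal) ∧
      ∀ V : X → ℝ, M.SoftBellman π' η V ρ →
        IsPolicy (M.softPolicy π' η V) ∧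
        ∀ μ ∈ M.stationarySet,
          (IsMaxOn (M.regReward π' η) M.stationarySet μ ↔
            ∀ x, 0 < stateMarginal μ x → ∀ a,
              inducedPolicy μ x a = M.softPolicy π' η V x a) := by
  have hsub := hM.stationarySet_subset_condDivDomain hμ' hπ' hfull
  obtain ⟨hπ', -⟩ := hπ'
  have hX : Nonempty X := by
    by_contra hX
    rw [not_nonempty_iff] at hX
    simpa using hμ'.1.2
  obtain ⟨V, ρ, hV⟩ := hM.exists_softBellman hπ' hη
  have hgreatest := hV.isGreatest hM hπ' hsub hη
  refine ⟨M.softBellman_iff_exists_isMaxOn hπ' hη, fun V lam h => h.dualFunction_eq hπ' hη,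
    ρ, hgreatest, ⟨⟨V, hV⟩, ?_⟩, ⟨⟨V, ρ, 0, fun _ => le_rfl, (hV.dualFunction_eq hπ' hη).symm⟩, ?_⟩,
    fun V hV => ⟨M.softPolicy_isPolicy hπ' η V, fun μ hμ => hV.isMaxOn_iff hM hπ' hsub hη hμ⟩⟩
  · rintro lam ⟨W, hW⟩
    -- Every solution has the primal maximum as its `lam`, so the dual feasible values form a single
    -- point.
    exact (hgreatest.unique (hW.isGreatest hM hπ' hsub hη)).le
  · rintro _ ⟨W, lam, φ, hφ, rfl⟩
    obtain ⟨μ, hμ, rfl⟩ := hgreatest.1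
    exact FiniteMDP.regReward_le_dualFunction η W lam hφ hμ (hsub hμ)
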